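/- Let $a,b,c,d\in\mathbb{R}^3$ be the vertices of a regular tetrahedron with sides of length $2$, and let $T$ be its Reuleaux tetrahedron, the intersection of the four closed balls of radius $2$ centered at the vertices. **Robert's body.** A *parabolic pea pod device* $\Sigma$ with beam $ab$ consists of a principal circle of center $o\notin ab$ and radius $r$ that has $ab$ as a chord, in the plane $H_\Sigma$ through $a,b,o$. Its *axis* is the line through $o$ and the midpoint of $ab$. $E(\Sigma)$ is the closed arc from $a$ to $b$ formed by the centers $x\in H_\Sigma$, lying in the closed half plane bounded by the line $ab$ opposite to $o$, of the (possibly degenerate) disks tangent to the line $ab$ and internally tangent to the principal circle; $R(x)$ denotes the radius of the disk centered at $x$. This arc lies on a parabola in $H_\Sigma$ with focus $o$, the *pea string*. Two such devices $\Sigma_1,\Sigma_2$, with beams $ab$ and $cd$ and principal centers $o_1,o_2$, are *convex confocal* if they have the same axis, their planes are orthogonal, the focus of each pea string lies on the other pea string, $o_1$ is the point of $E(\Sigma_2)$ on the axis, and $o_2$ is the point of $E(\Sigma_1)$ on the axis. For the regular tetrahedron there is exactly one such pair. The *wedge-pod surface* $(AB)$ is the set of all points $$\phi(x,y)=x+R(x)\,\frac{x-y}{|x-y|},\qquad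 x\in E(\Sigma_1),\ y\in E(\Sigma_2),$$ and its boundary curve on the sphere $\mathbb{S}(c,2)$ is $\tilde C_{AB}=\{\phi(x,c): x\in E(\Sigma_1)\}$. The wedge-pod surfaces along the other five edges, and their boundary curves, are defined in the same way. For each vertex, say $c$, the *spherical cap* $(C)$ is the part of $\mathbb{S}(c,2)$ that is bounded by the closed curve $\tilde C_{AB}\cup\tilde C_{BD}\cup\tilde C_{DA}$ and contained in the boundary of $T$. *Robert's body* $\mathcal{R}$ is the convex hull of the union of the four spherical caps and the six wedge-pod surfaces. **Meissner bodies.** Given a regular tetrahedron of side $1$ and its Reuleaux tetrahedron of width $1$, *rounding* the edge with end points $a',b'$ (the other two vertices being $c',d'$) means replacing the part of the Reuleaux tetrahedron in the dihedral wedge bounded by the half planes of $a'b'c'$ and $a'b'd'$ that lie beyond the line $a'b'$ by the part in that wedge of the solid of revolution generated by rotating about $a'b'$ the circular segment between $a'b'$ and the minor arc of radius $1$ from $a'$ to $b'$. The two Meissner bodies of constant width $1$ are obtained by rounding the three edges at one vertex, respectively the three edges of one face. **Theorem.** Let $M_1$ and $M_2$ be the two Meissner bodies of constant width $1$ over the regular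 tetrahedron $\frac a2,\frac b2,\frac c2,\frac d2$: $M_1$ with the three edges at some vertex rounded, and $M_2$ with the three edges of some face rounded (any vertex and any face). Then the Minkowski sum $M_1+M_2$ is not Robert's body: $$M_1+M_2\neq\mathcal{R}.$$ Moreover, the two bodies have different sections: if $H$ is the plane that contains an edge of the tetrahedron $abcd$ and passes through the midpoint of the opposite edge, then $H\cap(M_1+M_2)\neq H\cap\mathcal{R}$. -/

import Mathlib

open scoped Pointwise

noncomputable section

namespace Peabody

/-- Euclidean 3-space. -/
abbrev E3 := EuclideanSpace ℝ (Fin 3)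

/-- `p` lists the vertices of a regular tetrahedron with sides of length `s`. -/
def IsRegularTetrahedron (p : Fin 4 → E3) (s : ℝ) : Prop :=
  ∀ i j, i ≠ j → dist (p i) (p j) = s

/-- The intersection of the four balls of radius `s` centered at the vertices `p i`: the Reuleaux
tetrahedron, when `p` is a regular tetrahedron of side `s`. -/
def reuleauxTetrahedron (p : Fin 4 → E3) (s : ℝ) : Set E3 :=
  ⋂ i, Metric.closedBall (p i) s

/-! ### Parabolic pea pod devices -/

/-- A parabolic pea pod frame whose longitudinal beam is the segment `ab`: the principal circle
(with the given center and radius, in the plane of `a`, `b` and the center) has `ab` as a chord,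
and the second circle of the frame is the line through `a` and `b`. -/
structure ParabolicPod (a b : E3) where
  center : E3
  radius : ℝ
  dist_left : dist center a = radius
  dist_right : dist center b = radius
  center_notMem : center ∉ line[ℝ, a, b]

namespace ParabolicPod

variable {a b : E3}

/-- The plane of the frame. -/
def plane (S : ParabolicPod a b) : AffineSubspace ℝ E3 :=
  affineSpan ℝ {a, b, S.center}

/-- The axis of the frame: the line through the center of the principal circle and the midpoint of
the beam (it is perpendicular to the beam). -/
def axis (S : ParabolicPod a b) : AffineSubspace ℝ E3 :=
  line[ℝ, S.center, midpoint ℝ a b]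

/-- The radius of the ball of the pea pod centered at `x`: the disk around `x` is tangent to the
line through the beam. -/
def peaRadius (_S : ParabolicPod a b) (x : E3) : ℝ :=
  Metric.infDist x (line[ℝ, a, b] : Set E3)

/-- The set `E(Σ)` of the centers of the disks of the pea pod. These disks lie in the plane of the
frame, their centers lie in the half plane of the beam opposite to the principal center, and they
are tangent to the beam and, from inside, to the principal circle. The degenerate disks `{a}` and
`{b}` are included, so that this is a closed arc from `a` to `b`. -/
def arc (S : ParabolicPod a b) : Set E3 :=
  {x | x ∈ S.plane ∧ line[ℝ, a, b].WOppSide S.center x ∧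
    dist x S.center + S.peaRadius x = S.radius}

/-- The line parallel to the beam, at distance `radius` from it, on the side opposite to the
principal center. -/
def directrix (S : ParabolicPod a b) : AffineSubspace ℝ E3 :=
  AffineSubspace.mk'
    (midpoint ℝ a b +
      (S.radius / dist (midpoint ℝ a b) S.center) • (midpoint ℝ a b - S.center))
    (Submodule.span ℝ {b - a})

/-- The parabolic pea string: the parabola in the plane of the frame that contains the centers of
the disks. Its focus is the center of the principal circle. -/
def peaString (S : ParabolicPod a b) : Set E3 :=
  {x | x ∈ S.plane ∧ dist x S.center = Metric.infDist x (S.directrix : Set E3)}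

/-- `x` is the center of the bulb, the ball of the pea pod whose center lies on the axis. -/
def IsBulbCenter (S : ParabolicPod a b) (x : E3) : Prop :=
  x ∈ S.arc ∧ x ∈ S.axis

end ParabolicPod

/-- Confocal parabolic pea pod devices: they have the same axis, their planes are orthogonal, and
their pea strings are confocal, that is, the focus of each of the two parabolas lies on the
other. -/
def Confocal {a b c d : E3} (S : ParabolicPod a b) (S' : ParabolicPod c d) : Prop :=
  S.axis = S'.axis ∧
  S.plane.directionᗮ ≤ S'.plane.direction ∧
  S.center ∈ S'.peaString ∧ S'.center ∈ S.peaString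

/-- Convex confocal devices: moreover, the center of the principal circle of each device is the
center of the bulb of the other one. -/
def ConvexConfocal {a b c d : E3} (S : ParabolicPod a b) (S' : ParabolicPod c d) : Prop :=
  Confocal S S' ∧ S'.IsBulbCenter S.center ∧ S.IsBulbCenter S'.center

/-- The point of the line through `x` and `y` at distance `ρ` from `x` such that `x` lies between
it and `y`. -/
def outerPoint (ρ : ℝ) (x y : E3) : E3 :=
  x + (ρ / dist x y) • (x - y)

/-! ### Robert's body -/

/-- The wedge-pod surface along `ab` of the convex confocal pair of parabolic pea pod devices with
longitudinal beams `ab` and `cd` (when `a, b, c, d` is a regular tetrahedron, there is exactly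
one such pair). The wedge-pod surface along `cd` is `wedgePod c d a b`. -/
def wedgePod (a b c d : E3) : Set E3 :=
  {q | ∃ (S : ParabolicPod a b) (S' : ParabolicPod c d), ConvexConfocal S S' ∧
    ∃ x ∈ S.arc, ∃ y ∈ S'.arc, q = outerPoint (S.peaRadius x) x y}

/-- The boundary curve of `wedgePod a b c d` that lies on the sphere centered at `c`: the points of
this surface obtained for `y = c`. It joins `a` and `b`. -/
def wedgeCurve (a b c d : E3) : Set E3 :=
  {q | ∃ (S : ParabolicPod a b) (S' : ParabolicPod c d), ConvexConfocal S S' ∧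
    ∃ x ∈ S.arc, q = outerPoint (S.peaRadius x) x c}

/-- The closed curve on the sphere centered at the vertex `p i` that is made of the three boundary
curves of the wedge-pod surfaces along the edges of the face opposite to `p i`. -/
def capCurve (p : Fin 4 → E3) (i : Fin 4) : Set E3 :=
  ⋃ (σ : Equiv.Perm (Fin 4)) (_ : σ 2 = i),
    wedgeCurve (p (σ 0)) (p (σ 1)) (p (σ 2)) (p (σ 3))

/-- The closed spherical cap of the sphere of radius `s` around `p i` that is bounded by
`capCurve p i` and contained in the boundary of the Reuleaux tetrahedron: the curve, together with
the component of its complement in the sphere that is contained in that boundary. -/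
def sphericalCap (p : Fin 4 → E3) (s : ℝ) (i : Fin 4) : Set E3 :=
  {q | q ∈ Metric.sphere (p i) s ∧
    (q ∈ capCurve p i ∨
      connectedComponentIn (Metric.sphere (p i) s \ capCurve p i) q ⊆
        frontier (reuleauxTetrahedron p s))}

/-- The surface assembled from the four spherical caps and the six wedge-pod surfaces. -/
def robertsSurface (p : Fin 4 → E3) (s : ℝ) : Set E3 :=
  (⋃ i, sphericalCap p s i) ∪
    ⋃ σ : Equiv.Perm (Fin 4), wedgePod (p (σ 0)) (p (σ 1)) (p (σ 2)) (p (σ 3))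

/-- Robert's body over the regular tetrahedron `p` with sides of length `2`. -/
def robertsBody (p : Fin 4 → E3) : Set E3 :=
  convexHull ℝ (robertsSurface p 2)

/-! ### The Meissner bodies -/

/-- The dihedral wedge with edge the line `ab`, bounded by the half planes of the faces `abc` and
`abd` that lie beyond `ab`, opposite to `c` and to `d`. -/
def dihedralWedge (a b c d : E3) : Set E3 :=
  {x | ∃ t s s' : ℝ, 0 ≤ s ∧ 0 ≤ s' ∧ x = a + t • (b - a) + s • (a - c) + s' • (a - d)}

/-- The circular segment in the plane `abc`, beyond `ab` as seen from `c`, bounded by the segment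
`ab` and the arc from `a` to `b` of the circle of radius `s` centered at `c`. -/
def circularSegment (a b c : E3) (s : ℝ) : Set E3 :=
  {x | (∃ t u : ℝ, 0 ≤ u ∧ x = a + t • (b - a) + u • (a - c)) ∧ dist x c ≤ s}

/-- The solid of revolution generated by rotating `circularSegment a b c s` about the line `ab`.
Two points lie on the same circle about that line iff they have the same distances to `a` and
to `b`. -/
def spindle (a b c : E3) (s : ℝ) : Set E3 :=
  {x | ∃ y ∈ circularSegment a b c s, dist x a = dist y a ∧ dist x b = dist y b}

/-- The body obtained from the Reuleaux tetrahedron of width `s` over `p` by rounding the edges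
`ij` with `rounded i j`: the part of it in the dihedral wedge along such an edge is replaced by
the part of the solid of revolution in that wedge. -/
def roundedReuleaux (p : Fin 4 → E3) (s : ℝ) (rounded : Fin 4 → Fin 4 → Prop) : Set E3 :=
  {x | x ∈ reuleauxTetrahedron p s ∧ ∀ σ : Equiv.Perm (Fin 4), rounded (σ 0) (σ 1) →
    x ∈ dihedralWedge (p (σ 0)) (p (σ 1)) (p (σ 2)) (p (σ 3)) →
    x ∈ spindle (p (σ 0)) (p (σ 1)) (p (σ 2)) s}

/-- The Meissner body in which the three edges at the vertex `p v` are rounded. -/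
def meissnerVertex (p : Fin 4 → E3) (s : ℝ) (v : Fin 4) : Set E3 :=
  roundedReuleaux p s fun i j => i = v ∨ j = v

/-- The Meissner body in which the three edges of the face opposite to the vertex `p w` are
rounded. -/
def meissnerFace (p : Fin 4 → E3) (s : ℝ) (w : Fin 4) : Set E3 :=
  roundedReuleaux p s fun i j => i ≠ w ∧ j ≠ w

end Peabody

end

/-!
The bodies are compared through their support functions in the directions parallel to the plane of
the section. Let `C` be the component of such a unit vector along the axis towards the midpoint of
the opposite edge, the top edge. Doubling the two summands turns them into rounded Reuleaux
tetrahedra of width `2`, and the support function of the sum is the average of theirs. Near the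
axis, these are at most `√3 C`, and at most `√2 C + (2 - √3)` if the top edge is rounded. Robert's
body, however, contains the top of the disk of radius `ρ = (2 - √2) / 4` around the principal center
at height `√2 + ρ`, so that its support function is at least `(√2 + ρ) C + ρ`.

If just one summand has its top edge rounded, then the difference between this bound and the average
is a positive multiple of `(2 √3 - (2 + √2)) (1 - C)`, hence positive in the slanted directions
`C < 1`. If both have it rounded, then already the direction `C = 1` of the axis separates the
bodies. A Meissner body rounds one of any two opposite edges. So either one of the summands rounds
the edge opposite to the plane of the section, or both round the edge in this plane; in the latter
case that edge is taken as the top, and the separating point lies on the axis, which is contained in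
both planes.
-/

namespace Peabody

open scoped RealInnerProductSpace

section RealInequalities

theorem mul_add_mul_le_mul {p q r x y s : ℝ} (hr : 0 ≤ r) (hs : 0 ≤ s)
    (hpq : p ^ 2 + q ^ 2 ≤ r ^ 2) (hxy : x ^ 2 + y ^ 2 ≤ s ^ 2) : p * x + q * y ≤ r * s := by
  refine (abs_le_of_sq_le_sq' ?_ (mul_nonneg hr hs)).2
  calc (p * x + q * y) ^ 2 ≤ (p ^ 2 + q ^ 2) * (x ^ 2 + y ^ 2) := by
        linarith [sq_nonneg (p * y - q * x)]
    _ ≤ r ^ 2 * s ^ 2 := by gcongr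
    _ = (r * s) ^ 2 := by ring

theorem two_add_sqrt_two_lt : 2 + √2 < 2 * √3 := by
  have h2 : √2 < 3 / 2 := (Real.sqrt_lt' (by norm_num)).2 (by norm_num)
  refine lt_of_pow_lt_pow_left₀ 2 (by positivity) ?_
  rw [add_sq, mul_pow, Real.sq_sqrt (by norm_num), Real.sq_sqrt (by norm_num)]
  linarith

theorem sqrt_three_div_two_lt_one : √3 / 2 < 1 := by
  linarith [(Real.sqrt_lt' (x := 3) two_pos).2 (by norm_num)]

theorem sqrt_three_mul_abs_le {S C : ℝ} (hSC : S ^ 2 + C ^ 2 = 1) (hC : √3 / 2 ≤ C) :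
    √3 * |S| ≤ C := by
  have h3 : √3 ^ 2 = 3 := Real.sq_sqrt (by norm_num)
  have hC2 : (√3 / 2) ^ 2 ≤ C ^ 2 := by gcongr
  rw [div_pow, h3] at hC2
  refine (sq_le_sq₀ (by positivity) (hC.trans' (by positivity))).1 ?_
  rw [mul_pow, h3, sq_abs]
  linarith

end RealInequalities

section Frames

variable {V : Type*} [NormedAddCommGroup V] [InnerProductSpace ℝ V]

theorem mem_line_add_smul_iff {x v y : V} {s t : ℝ} (hst : s ≠ t) :
    y ∈ line[ℝ, x + s • v, x + t • v] ↔ ∃ r : ℝ, y = x + r • v := by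
  simp only [mem_affineSpan_pair_iff_exists_lineMap_eq, AffineMap.lineMap_apply, vsub_eq_sub,
    vadd_eq_add]
  constructor
  · rintro ⟨r, rfl⟩
    exact ⟨s + r * (t - s), by module⟩
  · rintro ⟨r, rfl⟩
    refine ⟨(r - s) / (t - s), ?_⟩
    have hr : r = (r - s) / (t - s) * (t - s) + s := by
      rw [div_mul_cancel₀ _ (sub_ne_zero.2 hst.symm), sub_add_cancel]
    conv_rhs => rw [hr]
    module

theorem inner_midpoint_sub (v x y o : V) :
    ⟪v, midpoint ℝ x y - o⟫ = (⟪v, x - o⟫ + ⟪v, y - o⟫) / 2 := by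
  have h : midpoint ℝ x y - o = (2 : ℝ)⁻¹ • ((x - o) + (y - o)) := by
    rw [midpoint_eq_smul_add, invOf_eq_inv]
    module
  rw [h, real_inner_smul_right, inner_add_right]
  ring

theorem infDist_eq_of_forall_le {α : Type*} [PseudoMetricSpace α] {s : Set α}
    {x y : α} {r : ℝ} (hy : y ∈ s) (hxy : dist x y = r) (h : ∀ z ∈ s, r ≤ dist x z) :
    Metric.infDist x s = r :=
  le_antisymm (hxy ▸ Metric.infDist_le_dist_of_mem hy) ((Metric.le_infDist ⟨y, hy⟩).2 fun _ => h _)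

/-- A system of Cartesian coordinates on (a three-dimensional subspace of) `V`. -/
@[ext]
structure OrthonormalFrame (V : Type*) [NormedAddCommGroup V] [InnerProductSpace ℝ V] where
  origin : V
  dir : Fin 3 → V
  orthonormal : Orthonormal ℝ dir

namespace OrthonormalFrame

variable (F : OrthonormalFrame V)

/-- The point with coordinates `X, Y, Z`. -/
def point (X Y Z : ℝ) : V :=
  F.origin + X • F.dir 0 + Y • F.dir 1 + Z • F.dir 2

/-- The vector with coordinates `S, 0, C`. The support functions of the bodies are compared in these
directions, as the planes of the sections contain the first and the third axis. -/
def dirXZ (S C : ℝ) : V :=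
  S • F.dir 0 + C • F.dir 2

theorem inner_dir (i j : Fin 3) : ⟪F.dir i, F.dir j⟫ = if i = j then 1 else 0 :=
  orthonormal_iff_ite.1 F.orthonormal i j

theorem inner_dirXZ_point (S C X Y Z : ℝ) :
    ⟪F.dirXZ S C, F.point X Y Z - F.origin⟫ = S * X + C * Z := by
  have h : F.point X Y Z - F.origin = X • F.dir 0 + Y • F.dir 1 + Z • F.dir 2 := by
    simp only [point]; module
  rw [h]
  simp [dirXZ, inner_add_left, inner_add_right, real_inner_smul_left, real_inner_smul_right,
    inner_dir, mul_comm, -inner_self_eq_norm_sq_to_K]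

theorem norm_dirXZ {S C : ℝ} (hSC : S ^ 2 + C ^ 2 = 1) : ‖F.dirXZ S C‖ = 1 := by
  have h := F.inner_dirXZ_point S C S 0 C
  rw [show F.point S 0 C - F.origin = F.dirXZ S C by simp only [point, dirXZ]; module,
    real_inner_self_eq_norm_sq] at h
  exact (sq_eq_sq₀ (norm_nonneg _) zero_le_one).1 (by linarith)

theorem dist_point_sq (X Y Z X' Y' Z' : ℝ) :
    dist (F.point X Y Z) (F.point X' Y' Z') ^ 2 =
      (X - X') ^ 2 + (Y - Y') ^ 2 + (Z - Z') ^ 2 := by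
  have h : F.point X Y Z - F.point X' Y' Z' =
      (X - X') • F.dir 0 + (Y - Y') • F.dir 1 + (Z - Z') • F.dir 2 := by
    simp only [point]; module
  rw [dist_eq_norm, h, ← real_inner_self_eq_norm_sq]
  simp only [inner_add_left, inner_add_right, real_inner_smul_left, real_inner_smul_right,
    inner_dir, Fin.reduceEq, if_true, if_false]
  ring

theorem dist_point_le_iff {X Y Z X' Y' Z' r : ℝ} (hr : 0 ≤ r) :
    dist (F.point X Y Z) (F.point X' Y' Z') ≤ r ↔
      (X - X') ^ 2 + (Y - Y') ^ 2 + (Z - Z') ^ 2 ≤ r ^ 2 := by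
  rw [← F.dist_point_sq, sq_le_sq₀ dist_nonneg hr]

theorem le_dist_point_iff {X Y Z X' Y' Z' r : ℝ} (hr : 0 ≤ r) :
    r ≤ dist (F.point X Y Z) (F.point X' Y' Z') ↔
      r ^ 2 ≤ (X - X') ^ 2 + (Y - Y') ^ 2 + (Z - Z') ^ 2 := by
  rw [← F.dist_point_sq, sq_le_sq₀ hr dist_nonneg]

theorem dist_point_eq_iff {X Y Z X' Y' Z' r : ℝ} (hr : 0 ≤ r) :
    dist (F.point X Y Z) (F.point X' Y' Z') = r ↔
      (X - X') ^ 2 + (Y - Y') ^ 2 + (Z - Z') ^ 2 = r ^ 2 := by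
  rw [← F.dist_point_sq, sq_eq_sq₀ dist_nonneg hr]

theorem eq_sum_inner_smul_dir (hV : Module.finrank ℝ V = 3) (v : V) :
    v = ⟪F.dir 0, v⟫ • F.dir 0 + ⟪F.dir 1, v⟫ • F.dir 1 + ⟪F.dir 2, v⟫ • F.dir 2 := by
  let B := (basisOfOrthonormalOfCardEqFinrank F.orthonormal (by simp [hV])).toOrthonormalBasis
    (by simpa using F.orthonormal)
  have hB : ∀ i, B i = F.dir i := by simp [B]
  simpa only [Fin.sum_univ_three, hB] using (B.sum_repr' v).symm

theorem exists_eq_point (hV : Module.finrank ℝ V = 3) (x : V) :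
    ∃ X Y Z, x = F.point X Y Z := by
  refine ⟨⟪F.dir 0, x - F.origin⟫, ⟪F.dir 1, x - F.origin⟫, ⟪F.dir 2, x - F.origin⟫, ?_⟩
  rw [point, add_assoc, add_assoc, ← add_assoc (_ • F.dir 0),
    ← F.eq_sum_inner_smul_dir hV (x - F.origin), add_sub_cancel]

/-- The frame with the origin moved by `h` along the third axis, the third axis reversed, and the
first two axes exchanged. -/
def flip (h : ℝ) : OrthonormalFrame V where
  origin := F.point 0 0 h
  dir := ![F.dir 1, F.dir 0, -F.dir 2]
  orthonormal := by
    rw [orthonormal_iff_ite]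
    intro i j
    fin_cases i <;> fin_cases j <;> simp [inner_dir, -inner_self_eq_norm_sq_to_K]

theorem point_flip (h X Y Z : ℝ) : (F.flip h).point X Y Z = F.point Y X (h - Z) := by
  simp only [point, flip, Matrix.cons_val_zero, Matrix.cons_val_one, Matrix.cons_val]
  module

theorem flip_flip (h : ℝ) : (F.flip h).flip h = F := by
  ext1
  · change (F.flip h).point 0 0 h = F.origin
    rw [point_flip]
    simp [point]
  · funext i
    fin_cases i <;> simp [flip]

end OrthonormalFrame

/-- Coordinates adapted to the regular tetrahedron `abcd` of side `2`: the origin is the midpoint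
of `ab`, the first axis is parallel to `ab`, the second one is parallel to `cd`, and the third one
is directed to the midpoint of `cd`. -/
@[ext]
structure AdaptedFrame (a b c d : V) extends OrthonormalFrame V where
  eq_a : a = toOrthonormalFrame.point 1 0 0
  eq_b : b = toOrthonormalFrame.point (-1) 0 0
  eq_c : c = toOrthonormalFrame.point 0 1 √2
  eq_d : d = toOrthonormalFrame.point 0 (-1) √2

theorem orthonormal_of_inner_eq_two {A B C : V} (hA : ‖A‖ = 2) (hB : ‖B‖ = 2) (hC : ‖C‖ = 2)
    (hAB : ⟪A, B⟫ = 2) (hAC : ⟪A, C⟫ = 2) (hBC : ⟪B, C⟫ = 2) :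
    Orthonormal ℝ ![(1 / 2 : ℝ) • (A - B), (1 / 2 : ℝ) • C, (√2 / 4) • (C - A - B)] := by
  have hs : √2 * √2 = 2 := Real.mul_self_sqrt (by norm_num)
  have inner_self : ∀ {x : V}, ‖x‖ = 2 → ⟪x, x⟫ = 4 := by
    intro x hx
    rw [real_inner_self_eq_norm_sq, hx]
    norm_num
  rw [orthonormal_iff_ite]
  intro i j
  fin_cases i <;> fin_cases j <;>
    simp [inner_sub_left, inner_sub_right, real_inner_smul_left, real_inner_smul_right,
      inner_self hA, inner_self hB, inner_self hC, hAB, hAC, hBC, real_inner_comm A B,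
      real_inner_comm A C, real_inner_comm B C, -inner_self_eq_norm_sq_to_K] <;>
    linarith

theorem nonempty_adaptedFrame {a b c d : V} (hab : dist a b = 2) (hac : dist a c = 2)
    (had : dist a d = 2) (hbc : dist b c = 2) (hbd : dist b d = 2) (hcd : dist c d = 2) :
    Nonempty (AdaptedFrame a b c d) := by
  have inner_eq_two : ∀ {x y : V}, dist x d = 2 → dist y d = 2 → dist x y = 2 →
      ⟪x - d, y - d⟫ = 2 := by
    intro x y hx hy hxy
    rw [real_inner_eq_norm_mul_self_add_norm_mul_self_sub_norm_sub_mul_self_div_two,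
      sub_sub_sub_cancel_right, ← dist_eq_norm, ← dist_eq_norm, ← dist_eq_norm, hx, hy, hxy]
    norm_num
  have hs : √2 * (√2 / 4) = 1 / 2 := by
    rw [← mul_div_assoc, Real.mul_self_sqrt (by norm_num)]; norm_num
  rw [dist_eq_norm] at had hbd hcd
  refine ⟨⟨⟨midpoint ℝ a b, _, orthonormal_of_inner_eq_two had hbd hcd
    (inner_eq_two ?_ ?_ hab) (inner_eq_two ?_ ?_ hac) (inner_eq_two ?_ ?_ hbc)⟩, ?_, ?_, ?_, ?_⟩⟩
  any_goals rwa [dist_eq_norm]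
  all_goals
    simp only [OrthonormalFrame.point, midpoint_eq_smul_add, Matrix.cons_val_zero,
      Matrix.cons_val_one, Matrix.cons_val, smul_smul, hs, invOf_eq_inv]
    module

namespace AdaptedFrame

variable {a b c d : V} (F : AdaptedFrame a b c d)

/-- The coordinates in which the edges `ab` and `cd` change their roles. -/
noncomputable def swap : AdaptedFrame c d a b where
  toOrthonormalFrame := F.flip √2
  eq_a := by rw [OrthonormalFrame.point_flip, sub_zero]; exact F.eq_c
  eq_b := by rw [OrthonormalFrame.point_flip, sub_zero]; exact F.eq_d
  eq_c := by rw [OrthonormalFrame.point_flip, sub_self]; exact F.eq_a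
  eq_d := by rw [OrthonormalFrame.point_flip, sub_self]; exact F.eq_b

theorem swap_point (X Y Z : ℝ) : F.swap.point X Y Z = F.point Y X (√2 - Z) :=
  F.point_flip √2 X Y Z

theorem swap_swap : F.swap.swap = F := by
  have h : F.swap.swap.toOrthonormalFrame = F.toOrthonormalFrame := F.flip_flip √2
  ext1
  · exact congrArg OrthonormalFrame.origin h
  · exact congrArg OrthonormalFrame.dir h

theorem midpoint_left_right : midpoint ℝ a b = F.point 0 0 0 := by
  refine (congrArg₂ (midpoint ℝ) F.eq_a F.eq_b).trans ?_
  rw [midpoint_eq_smul_add, invOf_eq_inv]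
  simp only [OrthonormalFrame.point]
  module

theorem mem_line_iff {x : V} : x ∈ line[ℝ, a, b] ↔ ∃ t, x = F.point t 0 0 := by
  have h := mem_line_add_smul_iff (x := F.origin) (v := F.dir 0) (y := x)
    (show (1 : ℝ) ≠ -1 by norm_num)
  have hline : line[ℝ, a, b] = line[ℝ, F.point 1 0 0, F.point (-1) 0 0] :=
    congrArg₂ (fun y z => line[ℝ, y, z]) F.eq_a F.eq_b
  rw [hline]
  simpa only [OrthonormalFrame.point, zero_smul, add_zero] using h

theorem mem_line_axis_iff {x : V} {s t : ℝ} (hst : s ≠ t) :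
    x ∈ line[ℝ, F.point 0 0 s, F.point 0 0 t] ↔ ∃ z, x = F.point 0 0 z := by
  simpa only [OrthonormalFrame.point, zero_smul, add_zero] using
    mem_line_add_smul_iff (x := F.origin) (v := F.dir 2) hst

theorem point_mem_affineSpan {h : ℝ} (hh : h ≠ 0) (X Z : ℝ) :
    F.point X 0 Z ∈ affineSpan ℝ {a, b, F.point 0 0 h} := by
  have hab : line[ℝ, a, b] ≤ affineSpan ℝ {a, b, F.point 0 0 h} :=
    affineSpan_mono ℝ (by simp [Set.insert_subset_iff])
  have h0 := hab (F.mem_line_iff.2 ⟨0, rfl⟩)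
  have hX := hab (F.mem_line_iff.2 ⟨X, rfl⟩)
  have hh' : F.point 0 0 h ∈ affineSpan ℝ {a, b, F.point 0 0 h} :=
    subset_affineSpan ℝ _ (by simp)
  convert AffineSubspace.smul_vsub_vadd_mem _ (Z / h) hh' h0 hX using 1
  rw [vsub_eq_sub, vadd_eq_add,
    show F.point 0 0 h - F.point 0 0 0 = h • F.dir 2 by simp only [OrthonormalFrame.point]; module,
    smul_smul, div_mul_cancel₀ _ hh]
  simp only [OrthonormalFrame.point]
  module

end AdaptedFrame

end Frames

section PeaPods

/-- The radius `ρ` of the bulb of each of the two pods of the convex confocal pair. As the bulb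
centers are at distance `ρ` from the midpoints of the edges, which are `√2` apart, the principal
circles have radius `√2 + 3ρ`, and a principal center is at distance `√2 + ρ` from its beam. Since
the beam is a chord of length `2`, `ρ` is the positive root of `(√2 + 3ρ)² = 1 + (√2 + ρ)²`. -/
noncomputable def bulbRadius : ℝ := (2 - √2) / 4

theorem four_mul_bulbRadius : 4 * bulbRadius = 2 - √2 := by
  rw [bulbRadius]; ring

theorem bulbRadius_pos : 0 < bulbRadius := by
  have h : √2 < 2 := (Real.sqrt_lt' (by norm_num)).2 (by norm_num)
  linarith [four_mul_bulbRadius]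

theorem principalRadius_sq : (√2 + 3 * bulbRadius) ^ 2 = 1 + (√2 + bulbRadius) ^ 2 := by
  have h : √2 ^ 2 = 2 := Real.sq_sqrt (by norm_num)
  rw [bulbRadius]
  linear_combination (-1 / 2) * h

theorem add_bulbRadius_le_mul_sqrt_three_div_two :
    √2 + bulbRadius ≤ (√2 + 3 * bulbRadius) * (√3 / 2) := by
  have h2 : √2 ^ 2 = 2 := Real.sq_sqrt (by norm_num)
  have hsqrt : √2 ≤ 3 / 2 := Real.sqrt_le_iff.2 (by norm_num)
  calc √2 + bulbRadius ≤ (√2 + 3 * bulbRadius) * ((2 + √2) / 2 / 2) := by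
        rw [bulbRadius]
        linarith
    _ ≤ (√2 + 3 * bulbRadius) * (√3 / 2) := by
        have hρ := bulbRadius_pos
        gcongr
        linarith [two_add_sqrt_two_lt]

theorem outerPoint_sub_smul {r l : ℝ} {x u : E3} (hl : 0 < l) (hu : ‖u‖ = 1) :
    outerPoint r x (x - l • u) = x + r • u := by
  rw [outerPoint, dist_eq_norm, sub_sub_cancel, norm_smul, hu, mul_one, Real.norm_of_nonneg hl.le,
    smul_smul, div_mul_cancel₀ _ hl.ne']

namespace AdaptedFrame

variable {a b c d : E3} (F : AdaptedFrame a b c d)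

/-- The pod with beam `ab` of the convex confocal pair with beams `ab` and `cd`; the other one is
`F.swap.pod`. -/
noncomputable def pod : ParabolicPod a b where
  center := F.point 0 0 (√2 + bulbRadius)
  radius := √2 + 3 * bulbRadius
  dist_left := by
    have := bulbRadius_pos
    refine (congrArg (dist _) F.eq_a).trans ((F.dist_point_eq_iff (by positivity)).2 ?_)
    rw [principalRadius_sq]
    ring
  dist_right := by
    have := bulbRadius_pos
    refine (congrArg (dist _) F.eq_b).trans ((F.dist_point_eq_iff (by positivity)).2 ?_)
    rw [principalRadius_sq]
    ring
  center_notMem := by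
    rw [F.mem_line_iff]
    rintro ⟨t, ht⟩
    have hpos : 0 < √2 + bulbRadius := add_pos (by positivity) bulbRadius_pos
    have hdist := F.dist_point_sq 0 0 (√2 + bulbRadius) t 0 0
    rw [ht, dist_self] at hdist
    nlinarith [sq_nonneg t, pow_pos hpos 2]

theorem pod_center : F.pod.center = F.point 0 0 (√2 + bulbRadius) := rfl

theorem pod_radius : F.pod.radius = √2 + 3 * bulbRadius := rfl

theorem swap_pod_center : F.swap.pod.center = F.point 0 0 (-bulbRadius) := by
  rw [pod_center, swap_point, sub_add_cancel_left]

theorem pod_center_sub_smul_dirXZ (l S C : ℝ) :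
    F.pod.center - l • F.dirXZ S C = F.point (-(l * S)) 0 (√2 + bulbRadius - l * C) := by
  simp only [pod_center, OrthonormalFrame.point, OrthonormalFrame.dirXZ]
  module

theorem point_mem_plane (X Z : ℝ) : F.point X 0 Z ∈ F.pod.plane :=
  F.point_mem_affineSpan (add_pos (by positivity) bulbRadius_pos).ne' X Z

theorem peaRadius_point (X Z : ℝ) : F.pod.peaRadius (F.point X 0 Z) = |Z| := by
  refine infDist_eq_of_forall_le (F.mem_line_iff.2 ⟨X, rfl⟩) ?_ fun z hz => ?_
  · rw [F.dist_point_eq_iff (abs_nonneg Z), sq_abs]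
    ring
  · obtain ⟨t, rfl⟩ := F.mem_line_iff.1 hz
    rw [F.le_dist_point_iff (abs_nonneg Z), sq_abs]
    linarith [sq_nonneg (X - t)]

theorem wOppSide_point {X Z : ℝ} (hZ : Z ≤ 0) :
    line[ℝ, a, b].WOppSide F.pod.center (F.point X 0 Z) := by
  refine ⟨F.point 0 0 0, F.mem_line_iff.2 ⟨0, rfl⟩, F.point X 0 0, F.mem_line_iff.2 ⟨X, rfl⟩, ?_⟩
  have hcenter : F.pod.center -ᵥ F.point 0 0 0 = (√2 + bulbRadius) • F.dir 2 := by
    simp only [pod_center, OrthonormalFrame.point, vsub_eq_sub]; module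
  have hpoint : F.point X 0 0 -ᵥ F.point X 0 Z = (-Z) • F.dir 2 := by
    simp only [OrthonormalFrame.point, vsub_eq_sub]; module
  rw [hcenter, hpoint]
  exact ((SameRay.refl _).nonneg_smul_left
    (add_pos (by positivity) bulbRadius_pos).le).nonneg_smul_right (neg_nonneg.2 hZ)

/-- `hpolar` is the polar equation of the pea string about its focus. -/
theorem center_sub_smul_dirXZ_mem_arc {S C l : ℝ} (hSC : S ^ 2 + C ^ 2 = 1) (hl : 0 ≤ l)
    (hlC : √2 + bulbRadius ≤ l * C) (hpolar : l * (1 + C) = 2 * √2 + 4 * bulbRadius) :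
    F.pod.center - l • F.dirXZ S C ∈ F.pod.arc := by
  have hdist : dist (F.pod.center - l • F.dirXZ S C) F.pod.center = l := by
    rw [dist_eq_norm, sub_sub_cancel_left, norm_neg, norm_smul, F.norm_dirXZ hSC, mul_one,
      Real.norm_of_nonneg hl]
  refine ⟨?_, ?_, ?_⟩
  · rw [pod_center_sub_smul_dirXZ]
    exact F.point_mem_plane _ _
  · rw [pod_center_sub_smul_dirXZ]
    exact F.wOppSide_point (sub_nonpos.2 hlC)
  · rw [hdist, pod_center_sub_smul_dirXZ, peaRadius_point, abs_of_nonpos (sub_nonpos.2 hlC),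
      pod_radius]
    linarith

theorem mem_axis_iff {x : E3} : x ∈ F.pod.axis ↔ ∃ z, x = F.point 0 0 z := by
  rw [ParabolicPod.axis, F.midpoint_left_right]
  exact F.mem_line_axis_iff (add_pos (by positivity) bulbRadius_pos).ne'

theorem axis_swap : F.swap.pod.axis = F.pod.axis := by
  ext x
  simp only [mem_axis_iff, swap_point]
  exact (Equiv.subLeft √2).exists_congr_left.trans (by simp)

theorem mem_directrix_iff {x : E3} :
    x ∈ F.pod.directrix ↔ ∃ t, x = F.point t 0 (-(√2 + 3 * bulbRadius)) := by
  have hpos : 0 < √2 + bulbRadius := add_pos (by positivity) bulbRadius_pos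
  have hdist : dist (F.point 0 0 0) F.pod.center = √2 + bulbRadius :=
    (F.dist_point_eq_iff hpos.le).2 (by ring)
  have hdiff : F.point 0 0 0 - F.pod.center = -(√2 + bulbRadius) • F.dir 2 := by
    simp only [pod_center, OrthonormalFrame.point]; module
  have hbeam : b - a = (-2 : ℝ) • F.dir 0 := by
    refine (congrArg₂ (· - ·) F.eq_b F.eq_a).trans ?_
    simp only [OrthonormalFrame.point]
    module
  rw [ParabolicPod.directrix, AffineSubspace.mem_mk', F.midpoint_left_right, pod_radius, hdist,
    hdiff, smul_smul, mul_neg, div_mul_cancel₀ _ hpos.ne', hbeam, Submodule.mem_span_singleton]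
  constructor
  · rintro ⟨t, ht⟩
    refine ⟨-2 * t, ?_⟩
    rw [vsub_eq_sub, eq_comm, sub_eq_iff_eq_add] at ht
    rw [ht]
    simp only [OrthonormalFrame.point]
    module
  · rintro ⟨t, rfl⟩
    refine ⟨-t / 2, ?_⟩
    simp only [OrthonormalFrame.point, vsub_eq_sub]
    module

theorem swap_center_mem_peaString : F.swap.pod.center ∈ F.pod.peaString := by
  have hpos : 0 ≤ √2 + 2 * bulbRadius := add_nonneg (by positivity) (by linarith [bulbRadius_pos])
  have hinfDist : Metric.infDist (F.point 0 0 (-bulbRadius)) (F.pod.directrix : Set E3) =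
      √2 + 2 * bulbRadius := by
    refine infDist_eq_of_forall_le (F.mem_directrix_iff.2 ⟨0, rfl⟩) ?_ fun z hz => ?_
    · exact (F.dist_point_eq_iff hpos).2 (by ring)
    · obtain ⟨t, rfl⟩ := F.mem_directrix_iff.1 hz
      rw [F.le_dist_point_iff hpos]
      linarith [sq_nonneg t]
  rw [swap_pod_center]
  exact ⟨F.point_mem_plane _ _, hinfDist ▸ (F.dist_point_eq_iff hpos).2 (by ring)⟩

theorem isBulbCenter_swap_center : F.pod.IsBulbCenter F.swap.pod.center := by
  have hpos := bulbRadius_pos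
  have hcenter : F.swap.pod.center =
      F.pod.center - (√2 + 2 * bulbRadius) • F.dirXZ 0 1 := by
    rw [swap_pod_center, pod_center_sub_smul_dirXZ]
    congr 1 <;> ring
  refine ⟨?_, F.mem_axis_iff.2 ⟨_, F.swap_pod_center⟩⟩
  rw [hcenter]
  exact F.center_sub_smul_dirXZ_mem_arc (by norm_num) (by positivity) (by linarith) (by ring)

theorem dirXZ_mem_plane_direction (S C : ℝ) : F.dirXZ S C ∈ F.pod.plane.direction := by
  convert AffineSubspace.vsub_mem_direction (F.point_mem_plane S C) (F.point_mem_plane 0 0) using 1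
  simp only [OrthonormalFrame.dirXZ, OrthonormalFrame.point, vsub_eq_sub]
  module

theorem plane_direction_swap_orthogonal_le :
    F.swap.pod.plane.directionᗮ ≤ F.pod.plane.direction := by
  intro v hv
  have hdir : F.dir 1 ∈ F.swap.pod.plane.direction := by
    convert F.swap.dirXZ_mem_plane_direction 1 0 using 1
    simp [OrthonormalFrame.dirXZ, swap, OrthonormalFrame.flip]
  have h0 : ⟪F.dir 1, v⟫ = 0 := (Submodule.mem_orthogonal _ v).1 hv _ hdir
  rw [F.eq_sum_inner_smul_dir (by simp) v, h0, zero_smul, add_zero]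
  exact F.dirXZ_mem_plane_direction _ _

theorem convexConfocal_swap : ConvexConfocal F.swap.pod F.pod := by
  have hstring := F.swap.swap_center_mem_peaString
  have hbulb := F.swap.isBulbCenter_swap_center
  rw [swap_swap] at hstring hbulb
  exact ⟨⟨F.axis_swap, F.plane_direction_swap_orthogonal_le, F.swap_center_mem_peaString, hstring⟩,
    F.isBulbCenter_swap_center, hbulb⟩

/-- The points of the wedge-pod surface along `cd` that lie on its bulb, in the plane of `ab` and
the axis. -/
noncomputable def bulbPoint (S C : ℝ) : E3 :=
  F.pod.center + bulbRadius • F.dirXZ S C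

theorem bulbPoint_eq_point (S C : ℝ) :
    F.bulbPoint S C = F.point (bulbRadius * S) 0 (√2 + bulbRadius + bulbRadius * C) := by
  simp only [bulbPoint, pod_center, OrthonormalFrame.point, OrthonormalFrame.dirXZ]
  module

theorem bulbPoint_mem_wedgePod {S C : ℝ} (hSC : S ^ 2 + C ^ 2 = 1)
    (hC : √2 + bulbRadius ≤ (√2 + 3 * bulbRadius) * C) :
    F.bulbPoint S C ∈ wedgePod c d a b := by
  have hρ := bulbRadius_pos
  have hC0 : 0 < C := pos_of_mul_pos_right (lt_of_lt_of_le (by positivity) hC) (by positivity)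
  set l := (2 * √2 + 4 * bulbRadius) / (1 + C)
  have hl : 0 < l := by positivity
  have hpolar : l * (1 + C) = 2 * √2 + 4 * bulbRadius := div_mul_cancel₀ _ (by positivity)
  have hlC : √2 + bulbRadius ≤ l * C := by
    rw [div_mul_eq_mul_div, le_div_iff₀ (by positivity)]
    linarith
  have hradius : F.swap.pod.peaRadius F.pod.center = bulbRadius := by
    have hcenter := F.swap.swap_pod_center
    rw [swap_swap] at hcenter
    rw [hcenter, peaRadius_point, abs_neg, abs_of_pos hρ]
  refine ⟨F.swap.pod, F.pod, F.convexConfocal_swap, F.pod.center,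
    F.convexConfocal_swap.2.2.1, _, F.center_sub_smul_dirXZ_mem_arc hSC hl.le hlC hpolar, ?_⟩
  rw [hradius, outerPoint_sub_smul hl (F.norm_dirXZ hSC), bulbPoint]

theorem bulbPoint_mem_affineSpan (S C : ℝ) :
    F.bulbPoint S C ∈ affineSpan ℝ {a, b, midpoint ℝ c d} := by
  rw [bulbPoint_eq_point, F.swap.midpoint_left_right, swap_point, sub_zero]
  exact F.point_mem_affineSpan (by positivity) _ _

theorem bulbPoint_zero_mem_affineSpan (C : ℝ) :
    F.bulbPoint 0 C ∈ affineSpan ℝ {c, d, midpoint ℝ a b} := by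
  have h := F.swap.point_mem_affineSpan (h := √2) (by positivity) 0
    (√2 - (√2 + bulbRadius + bulbRadius * C))
  rw [bulbPoint_eq_point, mul_zero]
  rwa [swap_point, swap_point, sub_sub_cancel, sub_self, ← F.midpoint_left_right] at h

theorem inner_dirXZ_bulbPoint {S C : ℝ} (hSC : S ^ 2 + C ^ 2 = 1) :
    ⟪F.dirXZ S C, F.bulbPoint S C - F.origin⟫ = (√2 + bulbRadius) * C + bulbRadius := by
  rw [bulbPoint_eq_point, F.inner_dirXZ_point]
  linear_combination bulbRadius * hSC

end AdaptedFrame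

end PeaPods

section Scaling

variable {k : ℝ}

theorem dist_smul_smul_of_pos {V : Type*} [SeminormedAddCommGroup V] [NormedSpace ℝ V]
    (hk : 0 < k) (x y : V) : dist (k • x) (k • y) = k * dist x y := by
  rw [dist_smul₀, Real.norm_of_nonneg hk.le]

theorem smul_mem_reuleauxTetrahedron_iff (hk : 0 < k) {p : Fin 4 → E3} {s : ℝ} {x : E3} :
    k • x ∈ reuleauxTetrahedron (fun i => k • p i) (k * s) ↔ x ∈ reuleauxTetrahedron p s := by
  simp only [reuleauxTetrahedron, Set.mem_iInter, Metric.mem_closedBall, dist_smul_smul_of_pos hk,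
    mul_le_mul_iff_right₀ hk]

theorem smul_mem_dihedralWedge_iff (hk : k ≠ 0) {a b c d x : E3} :
    k • x ∈ dihedralWedge (k • a) (k • b) (k • c) (k • d) ↔ x ∈ dihedralWedge a b c d := by
  simp only [dihedralWedge, Set.mem_ofPred_eq, ← smul_sub, smul_comm _ k, ← smul_add,
    smul_right_inj hk]

theorem smul_mem_circularSegment_iff (hk : 0 < k) {a b c x : E3} {s : ℝ} :
    k • x ∈ circularSegment (k • a) (k • b) (k • c) (k * s) ↔ x ∈ circularSegment a b c s := by
  simp only [circularSegment, Set.mem_ofPred_eq, ← smul_sub, smul_comm _ k, ← smul_add,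
    smul_right_inj hk.ne', dist_smul_smul_of_pos hk, mul_le_mul_iff_right₀ hk]

theorem smul_mem_spindle_iff (hk : 0 < k) {a b c x : E3} {s : ℝ} :
    k • x ∈ spindle (k • a) (k • b) (k • c) (k * s) ↔ x ∈ spindle a b c s := by
  refine (MulAction.surjective₀ hk.ne').exists.trans (exists_congr fun y => ?_)
  simp only [smul_mem_circularSegment_iff hk, dist_smul_smul_of_pos hk, mul_right_inj' hk.ne']

theorem smul_mem_roundedReuleaux_iff (hk : 0 < k) {p : Fin 4 → E3} {s : ℝ}
    {rounded : Fin 4 → Fin 4 → Prop} {x : E3} :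
    k • x ∈ roundedReuleaux (fun i => k • p i) (k * s) rounded ↔
      x ∈ roundedReuleaux p s rounded := by
  simp only [roundedReuleaux, Set.mem_ofPred_eq, smul_mem_reuleauxTetrahedron_iff hk,
    smul_mem_dihedralWedge_iff hk.ne', smul_mem_spindle_iff hk]

theorem exists_midpoint_eq_of_mem_add {p : Fin 4 → E3} {rounded rounded' : Fin 4 → Fin 4 → Prop}
    {q : E3} (hq : q ∈ roundedReuleaux (fun i => (1 / 2 : ℝ) • p i) 1 rounded +
      roundedReuleaux (fun i => (1 / 2 : ℝ) • p i) 1 rounded') :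
    ∃ x ∈ roundedReuleaux p 2 rounded, ∃ y ∈ roundedReuleaux p 2 rounded',
      midpoint ℝ x y = q := by
  have two_smul_mem : ∀ {r : Fin 4 → Fin 4 → Prop} {x : E3},
      x ∈ roundedReuleaux (fun i => (1 / 2 : ℝ) • p i) 1 r →
        (2 : ℝ) • x ∈ roundedReuleaux p 2 r := by
    intro r x hx
    have := smul_mem_roundedReuleaux_iff (k := 1 / 2) (p := p) (s := 2) (rounded := r)
      (x := (2 : ℝ) • x) (by norm_num)
    rwa [smul_smul, one_div_mul_cancel two_ne_zero, one_smul, iff_true_left hx] at this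
  obtain ⟨x, hx, y, hy, rfl⟩ := hq
  refine ⟨_, two_smul_mem hx, _, two_smul_mem hy, ?_⟩
  rw [midpoint_eq_smul_add, ← smul_add, smul_smul, invOf_mul_self, one_smul]

end Scaling

section SupportBounds

namespace AdaptedFrame

variable {a b c d : E3} (F : AdaptedFrame a b c d)

theorem abs_add_one_sq_add_sq_le {X Y Z : ℝ} (ha : dist (F.point X Y Z) a ≤ 2)
    (hb : dist (F.point X Y Z) b ≤ 2) : (|X| + 1) ^ 2 + Z ^ 2 ≤ 2 ^ 2 := by
  have ha' := F.dist_point_le_iff (X := X) (Y := Y) (Z := Z) (X' := 1) (Y' := 0) (Z' := 0)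
    zero_le_two
  have hb' := F.dist_point_le_iff (X := X) (Y := Y) (Z := Z) (X' := -1) (Y' := 0) (Z' := 0)
    zero_le_two
  rw [← F.eq_a, iff_true_left ha] at ha'
  rw [← F.eq_b, iff_true_left hb] at hb'
  rcases abs_cases X with ⟨hX, -⟩ | ⟨hX, -⟩ <;> rw [hX] <;> linarith [sq_nonneg Y]

theorem inner_dirXZ_le_of_dist_le {S C : ℝ} {x : E3} (hSC : √3 * |S| ≤ C) (ha : dist x a ≤ 2)
    (hb : dist x b ≤ 2) : ⟪F.dirXZ S C, x - F.origin⟫ ≤ √3 * C := by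
  obtain ⟨X, Y, Z, rfl⟩ := F.exists_eq_point (by simp) x
  rw [F.inner_dirXZ_point]
  have h3 : √3 ^ 2 = 3 := Real.sq_sqrt (by norm_num)
  have hXZ : 1 * (|X| + 1) + √3 * Z ≤ 2 * 2 :=
    mul_add_mul_le_mul zero_le_two zero_le_two (by rw [h3]; norm_num)
      (F.abs_add_one_sq_add_sq_le ha hb)
  refine le_of_mul_le_mul_left ?_ (show 0 < √3 by positivity)
  calc √3 * (S * X + C * Z) ≤ √3 * |S| * |X| + C * (√3 * Z) := by
        have h := mul_le_mul_of_nonneg_left (le_abs_self (S * X)) (Real.sqrt_nonneg 3)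
        rw [abs_mul] at h
        linarith
    _ ≤ C * |X| + C * (3 - |X|) := by
        have hC : 0 ≤ C := hSC.trans' (by positivity)
        gcongr
        linarith
    _ = √3 * (√3 * C) := by linear_combination -C * h3

theorem inner_dirXZ_le_of_mem_spindle {S C : ℝ} {x : E3} (hSC : S ^ 2 + C ^ 2 = 1)
    (hx : x ∈ spindle c d a 2) : ⟪F.dirXZ S C, x - F.origin⟫ ≤ √2 * C + (2 - √3) := by
  obtain ⟨X, Y, Z, rfl⟩ := F.exists_eq_point (by simp) x
  rw [F.inner_dirXZ_point]
  obtain ⟨F, rfl, rfl, rfl, rfl⟩ := F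
  dsimp only at hx ⊢
  have h2 : √2 ^ 2 = 2 := Real.sq_sqrt (by norm_num)
  have h3 : √3 ^ 2 = 3 := Real.sq_sqrt (by norm_num)
  obtain ⟨y, ⟨⟨t, u, hu, hy⟩, hya⟩, hc, hd⟩ := hx
  obtain rfl : y = F.point (-u) (1 - 2 * t + u) (√2 + √2 * u) := by
    rw [hy]; simp only [OrthonormalFrame.point]; module
  rw [F.dist_point_le_iff zero_le_two] at hya
  rw [← sq_eq_sq₀ dist_nonneg dist_nonneg, F.dist_point_sq, F.dist_point_sq] at hc hd
  have hY : Y = 1 - 2 * t + u := by linarith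
  have hradius : X ^ 2 + (Z - √2) ^ 2 = (√3 * u) ^ 2 := by
    rw [hY] at hc
    linear_combination hc + u ^ 2 * h2 - u ^ 2 * h3
  have hu' : √3 * (1 + u) ≤ 2 := by
    refine (sq_le_sq₀ (by positivity) zero_le_two).1 ?_
    linear_combination hya + sq_nonneg (1 - 2 * t + u) + (1 + u) ^ 2 * (h3 - h2)
  have hsupport : S * X + C * (Z - √2) ≤ 1 * (√3 * u) :=
    mul_add_mul_le_mul zero_le_one (by positivity) (by rw [hSC, one_pow]) hradius.le
  linarith

theorem point_mem_dihedralWedge {X Y Z : ℝ} (hXZ : √2 * |X| ≤ Z - √2) :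
    F.point X Y Z ∈ dihedralWedge c d a b := by
  obtain ⟨F, rfl, rfl, rfl, rfl⟩ := F
  have h2 : √2 * √2 = 2 := Real.mul_self_sqrt (by norm_num)
  obtain ⟨k, rfl⟩ : ∃ k, Z = √2 + 2 * k * √2 :=
    ⟨√2 / 4 * (Z - √2), by linear_combination (-(Z - √2) / 2) * h2⟩
  have hX : |X| ≤ 2 * k :=
    le_of_mul_le_mul_left (by linarith) (show 0 < √2 by positivity)
  obtain ⟨hX₁, hX₂⟩ := abs_le.1 hX
  refine ⟨(1 + 2 * k - Y) / 2, k - X / 2, k + X / 2, by linarith, by linarith, ?_⟩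
  simp only [OrthonormalFrame.point]
  module

theorem inner_dirXZ_le_of_notMem_dihedralWedge {S C : ℝ} {x : E3} (hSC : S ^ 2 + C ^ 2 = 1)
    (hC : √2 * |S| ≤ C) (ha : dist x a ≤ 2) (hb : dist x b ≤ 2)
    (hx : x ∉ dihedralWedge c d a b) :
    ⟪F.dirXZ S C, x - F.origin⟫ ≤ √2 * C + (2 - √3) := by
  obtain ⟨X, Y, Z, rfl⟩ := F.exists_eq_point (by simp) x
  rw [F.inner_dirXZ_point]
  have h2 : √2 ^ 2 = 2 := Real.sq_sqrt (by norm_num)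
  have h3 : √3 ^ 2 = 3 := Real.sq_sqrt (by norm_num)
  have h32 : √3 ≤ 2 := Real.sqrt_le_iff.2 (by norm_num)
  have hXZ : Z - √2 ≤ √2 * |X| := le_of_not_ge fun h => hx (F.point_mem_dihedralWedge h)
  have hball : 1 * (|X| + 1) + √2 * Z ≤ √3 * 2 :=
    mul_add_mul_le_mul (by positivity) zero_le_two (by rw [h2, h3]; norm_num)
      (F.abs_add_one_sq_add_sq_le ha hb)
  have hdir : 1 * |S| + √2 * C ≤ √3 * 1 :=
    mul_add_mul_le_mul (by positivity) zero_le_one (by rw [h2, h3]; norm_num)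
      (by rw [sq_abs, hSC, one_pow])
  -- Split `(|S|, C)` and `(|X|, Z - √2)` along the boundary direction `(1, √2)` of the wedge and
  -- its normal: outside the wedge, the normal components contribute a nonpositive term.
  have hprod : (|S| + √2 * C) * (|X| + √2 * (Z - √2)) ≤ √3 * (√3 * (2 - √3)) := by
    have hC0 : 0 ≤ C := hC.trans' (by positivity)
    have _h : 0 ≤ 2 - √3 := sub_nonneg.2 h32
    calc (|S| + √2 * C) * (|X| + √2 * (Z - √2)) ≤ (|S| + √2 * C) * (√3 * (2 - √3)) := by
          gcongr
          linarith
      _ ≤ √3 * (√3 * (2 - √3)) := by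
          gcongr
          linarith
  have hwedge : 0 ≤ (C - √2 * |S|) * (√2 * |X| - (Z - √2)) :=
    mul_nonneg (sub_nonneg.2 hC) (sub_nonneg.2 hXZ)
  have hSX : S * X ≤ |S| * |X| := (le_abs_self _).trans_eq (abs_mul S X)
  linear_combination hSX + hprod / 3 + hwedge / 3 +
    (-(|S| * |X|) / 3 - C * (Z - √2) / 3) * h2 + ((2 - √3) / 3) * h3

end AdaptedFrame

section RoundedBodies

theorem dist_le_of_mem_roundedReuleaux {p : Fin 4 → E3} {s : ℝ}
    {rounded : Fin 4 → Fin 4 → Prop} {x : E3} (hx : x ∈ roundedReuleaux p s rounded) (i : Fin 4) :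
    dist x (p i) ≤ s :=
  Set.mem_iInter.1 hx.1 i

variable {p : Fin 4 → E3} {rounded : Fin 4 → Fin 4 → Prop} {σ : Equiv.Perm (Fin 4)}
  (F : AdaptedFrame (p (σ 2)) (p (σ 3)) (p (σ 0)) (p (σ 1))) {S C : ℝ}

theorem inner_dirXZ_le_of_mem_roundedReuleaux {x : E3} (hSC : √3 * |S| ≤ C)
    (hx : x ∈ roundedReuleaux p 2 rounded) : ⟪F.dirXZ S C, x - F.origin⟫ ≤ √3 * C :=
  have hball := dist_le_of_mem_roundedReuleaux hx
  F.inner_dirXZ_le_of_dist_le hSC (hball _) (hball _)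

theorem inner_dirXZ_le_of_rounded {x : E3} (hSC : S ^ 2 + C ^ 2 = 1) (hC : √2 * |S| ≤ C)
    (hr : rounded (σ 0) (σ 1)) (hx : x ∈ roundedReuleaux p 2 rounded) :
    ⟪F.dirXZ S C, x - F.origin⟫ ≤ √2 * C + (2 - √3) := by
  have hball := dist_le_of_mem_roundedReuleaux hx
  by_cases hw : x ∈ dihedralWedge (p (σ 0)) (p (σ 1)) (p (σ 2)) (p (σ 3))
  · exact F.inner_dirXZ_le_of_mem_spindle hSC (hx.2 σ hr hw)
  · exact F.inner_dirXZ_le_of_notMem_dihedralWedge hSC hC (hball _) (hball _) hw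

theorem bulbPoint_mem_robertsBody (hSC : S ^ 2 + C ^ 2 = 1)
    (hC : √2 + bulbRadius ≤ (√2 + 3 * bulbRadius) * C) : F.bulbPoint S C ∈ robertsBody p :=
  subset_convexHull ℝ _ (Or.inr (Set.mem_iUnion.2 ⟨σ, F.bulbPoint_mem_wedgePod hSC hC⟩))

end RoundedBodies

end SupportBounds

section Comparison

theorem rounded_lt_bulb : √2 + (2 - √3) < √2 + 2 * bulbRadius := by
  linarith [four_mul_bulbRadius, two_add_sqrt_two_lt]

theorem rounded_add_unrounded_lt_bulb {C : ℝ} (hC : C < 1) :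
    √2 * C + (2 - √3) + √3 * C < 2 * ((√2 + bulbRadius) * C + bulbRadius) := by
  have h : 0 < (2 * √3 - (2 + √2)) * (1 - C) :=
    mul_pos (sub_pos.2 two_add_sqrt_two_lt) (sub_pos.2 hC)
  rw [bulbRadius]
  linarith

variable {p : Fin 4 → E3} {rounded rounded' : Fin 4 → Fin 4 → Prop}

theorem bulbPoint_notMem_add {a b c d : E3} (F : AdaptedFrame a b c d) {S C h h' : ℝ}
    (hSC : S ^ 2 + C ^ 2 = 1)
    (hr : ∀ x ∈ roundedReuleaux p 2 rounded, ⟪F.dirXZ S C, x - F.origin⟫ ≤ h)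
    (hr' : ∀ x ∈ roundedReuleaux p 2 rounded', ⟪F.dirXZ S C, x - F.origin⟫ ≤ h')
    (hlt : h + h' < 2 * ((√2 + bulbRadius) * C + bulbRadius)) :
    F.bulbPoint S C ∉
      roundedReuleaux (fun i => (1 / 2 : ℝ) • p i) 1 rounded +
        roundedReuleaux (fun i => (1 / 2 : ℝ) • p i) 1 rounded' := by
  intro hmem
  obtain ⟨x, hx, y, hy, hxy⟩ := exists_midpoint_eq_of_mem_add hmem
  have hq := F.inner_dirXZ_bulbPoint hSC
  rw [← hxy, inner_midpoint_sub] at hq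
  linarith [hr x hx, hr' y hy]

section TopEdgeRounded

variable {σ : Equiv.Perm (Fin 4)} (F : AdaptedFrame (p (σ 2)) (p (σ 3)) (p (σ 0)) (p (σ 1)))

theorem bulbPoint_notMem_add_of_rounded {S C : ℝ} (hSC : S ^ 2 + C ^ 2 = 1) (hC : √3 / 2 ≤ C)
    (hC1 : C < 1) (hr : rounded (σ 0) (σ 1)) :
    F.bulbPoint S C ∉
      roundedReuleaux (fun i => (1 / 2 : ℝ) • p i) 1 rounded +
        roundedReuleaux (fun i => (1 / 2 : ℝ) • p i) 1 rounded' := by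
  have h3 : √3 * |S| ≤ C := sqrt_three_mul_abs_le hSC hC
  have h2 : √2 * |S| ≤ C := h3.trans' (by gcongr; norm_num)
  exact bulbPoint_notMem_add F hSC (fun _ => inner_dirXZ_le_of_rounded F hSC h2 hr)
    (fun _ => inner_dirXZ_le_of_mem_roundedReuleaux F h3) (rounded_add_unrounded_lt_bulb hC1)

theorem bulbPoint_notMem_add_of_rounded_of_rounded (hr : rounded (σ 0) (σ 1))
    (hr' : rounded' (σ 0) (σ 1)) :
    F.bulbPoint 0 1 ∉
      roundedReuleaux (fun i => (1 / 2 : ℝ) • p i) 1 rounded +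
        roundedReuleaux (fun i => (1 / 2 : ℝ) • p i) 1 rounded' := by
  have hSC : (0 : ℝ) ^ 2 + 1 ^ 2 = 1 := by norm_num
  have h2 : √2 * |0| ≤ 1 := by norm_num
  exact bulbPoint_notMem_add F hSC (fun _ => inner_dirXZ_le_of_rounded F hSC h2 hr)
    (fun _ => inner_dirXZ_le_of_rounded F hSC h2 hr') (by linarith [rounded_lt_bulb])

end TopEdgeRounded

/-- The permutation of the vertices that exchanges the first pair with the last one, and so turns
the edge in the plane of a section into the edge opposite to this plane. -/
def swapPairs : Equiv.Perm (Fin 4) := Equiv.addRight 2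

theorem nonempty_adaptedFrame_perm (hp : IsRegularTetrahedron p 2) (σ : Equiv.Perm (Fin 4)) :
    Nonempty (AdaptedFrame (p (σ 2)) (p (σ 3)) (p (σ 0)) (p (σ 1))) := by
  apply nonempty_adaptedFrame <;> exact hp _ _ (by simp)

theorem exists_mem_section_notMem_add_of_rounded (hp : IsRegularTetrahedron p 2)
    (σ : Equiv.Perm (Fin 4)) (hr : rounded (σ 2) (σ 3)) :
    ∃ q ∈ affineSpan ℝ {p (σ 0), p (σ 1), midpoint ℝ (p (σ 2)) (p (σ 3))}, q ∈ robertsBody p ∧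
      q ∉ roundedReuleaux (fun i => (1 / 2 : ℝ) • p i) 1 rounded +
        roundedReuleaux (fun i => (1 / 2 : ℝ) • p i) 1 rounded' := by
  obtain ⟨F⟩ := nonempty_adaptedFrame_perm hp (σ * swapPairs)
  have hSC : (1 / 2 : ℝ) ^ 2 + (√3 / 2) ^ 2 = 1 := by
    rw [div_pow √3, Real.sq_sqrt (by norm_num)]
    norm_num
  refine ⟨F.bulbPoint (1 / 2) (√3 / 2), F.bulbPoint_mem_affineSpan _ _,
    bulbPoint_mem_robertsBody F hSC add_bulbRadius_le_mul_sqrt_three_div_two,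
    bulbPoint_notMem_add_of_rounded F hSC le_rfl sqrt_three_div_two_lt_one hr⟩

theorem exists_mem_section_notMem_add_of_rounded_of_rounded (hp : IsRegularTetrahedron p 2)
    (σ : Equiv.Perm (Fin 4)) (hr : rounded (σ 0) (σ 1)) (hr' : rounded' (σ 0) (σ 1)) :
    ∃ q ∈ affineSpan ℝ {p (σ 0), p (σ 1), midpoint ℝ (p (σ 2)) (p (σ 3))}, q ∈ robertsBody p ∧
      q ∉ roundedReuleaux (fun i => (1 / 2 : ℝ) • p i) 1 rounded +
        roundedReuleaux (fun i => (1 / 2 : ℝ) • p i) 1 rounded' := by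
  obtain ⟨F⟩ := nonempty_adaptedFrame_perm hp σ
  exact ⟨F.bulbPoint 0 1, F.bulbPoint_zero_mem_affineSpan 1,
    bulbPoint_mem_robertsBody F (by norm_num) (by linarith [bulbRadius_pos]),
    bulbPoint_notMem_add_of_rounded_of_rounded F hr hr'⟩

theorem exists_mem_section_notMem_add (hp : IsRegularTetrahedron p 2) (σ : Equiv.Perm (Fin 4))
    (hr : rounded (σ 0) (σ 1) ∨ rounded (σ 2) (σ 3))
    (hr' : rounded' (σ 0) (σ 1) ∨ rounded' (σ 2) (σ 3)) :
    ∃ q ∈ affineSpan ℝ {p (σ 0), p (σ 1), midpoint ℝ (p (σ 2)) (p (σ 3))}, q ∈ robertsBody p ∧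
      q ∉ roundedReuleaux (fun i => (1 / 2 : ℝ) • p i) 1 rounded +
        roundedReuleaux (fun i => (1 / 2 : ℝ) • p i) 1 rounded' := by
  obtain hr | hr := hr
  · obtain hr' | hr' := hr'
    · exact exists_mem_section_notMem_add_of_rounded_of_rounded hp σ hr hr'
    · rw [add_comm]
      exact exists_mem_section_notMem_add_of_rounded hp σ hr'
  · exact exists_mem_section_notMem_add_of_rounded hp σ hr

theorem eq_left_or_eq_right_of_perm (v : Fin 4) (σ : Equiv.Perm (Fin 4)) :
    (σ 0 = v ∨ σ 1 = v) ∨ (σ 2 = v ∨ σ 3 = v) := by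
  obtain ⟨i, rfl⟩ := σ.surjective v
  simp only [EmbeddingLike.apply_eq_iff_eq]
  revert i
  decide

theorem ne_left_or_ne_right_of_perm (w : Fin 4) (σ : Equiv.Perm (Fin 4)) :
    (σ 0 ≠ w ∧ σ 1 ≠ w) ∨ (σ 2 ≠ w ∧ σ 3 ≠ w) := by
  obtain ⟨i, rfl⟩ := σ.surjective w
  simp only [ne_eq, EmbeddingLike.apply_eq_iff_eq]
  revert i
  decide

end Comparison

end Peabody

open Peabody in
theorem mainTheorem4_general (p : Fin 4 → E3) (hp : IsRegularTetrahedron p 2)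
    (rounded rounded' : Fin 4 → Fin 4 → Prop)
    (hr : ∀ σ : Equiv.Perm (Fin 4), rounded (σ 0) (σ 1) ∨ rounded (σ 2) (σ 3))
    (hr' : ∀ σ : Equiv.Perm (Fin 4), rounded' (σ 0) (σ 1) ∨ rounded' (σ 2) (σ 3)) :
    roundedReuleaux (fun i => (1 / 2 : ℝ) • p i) 1 rounded +
        roundedReuleaux (fun i => (1 / 2 : ℝ) • p i) 1 rounded' ≠ robertsBody p ∧
    ∀ σ : Equiv.Perm (Fin 4),
      (affineSpan ℝ {p (σ 0), p (σ 1), midpoint ℝ (p (σ 2)) (p (σ 3))} : Set E3) ∩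
          (roundedReuleaux (fun i => (1 / 2 : ℝ) • p i) 1 rounded +
            roundedReuleaux (fun i => (1 / 2 : ℝ) • p i) 1 rounded') ≠
        (affineSpan ℝ {p (σ 0), p (σ 1), midpoint ℝ (p (σ 2)) (p (σ 3))} : Set E3) ∩
          robertsBody p := by
  have separating := fun σ => exists_mem_section_notMem_add hp σ (hr σ) (hr' σ)
  refine ⟨fun h => ?_, fun σ h => ?_⟩
  · obtain ⟨q, -, hbody, hsum⟩ := separating 1
    exact hsum (h.superset hbody)
  · obtain ⟨q, hq, hbody, hsum⟩ := separating σ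
    exact hsum (h.superset ⟨hq, hbody⟩).2

open Peabody in
theorem mainTheorem4 (p : Fin 4 → E3) (hp : IsRegularTetrahedron p 2) (v w : Fin 4) :
    meissnerVertex (fun i => (1 / 2 : ℝ) • p i) 1 v +
        meissnerFace (fun i => (1 / 2 : ℝ) • p i) 1 w ≠ robertsBody p ∧
    ∀ σ : Equiv.Perm (Fin 4),
      (affineSpan ℝ {p (σ 0), p (σ 1), midpoint ℝ (p (σ 2)) (p (σ 3))} : Set E3) ∩
          (meissnerVertex (fun i => (1 / 2 : ℝ) • p i) 1 v +
            meissnerFace (fun i => (1 / 2 : ℝ) • p i) 1 w) ≠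
        (affineSpan ℝ {p (σ 0), p (σ 1), midpoint ℝ (p (σ 2)) (p (σ 3))} : Set E3) ∩
          robertsBody p :=
  mainTheorem4_general p hp _ _ (eq_left_or_eq_right_of_perm v) (ne_left_or_ne_right_of_perm w)
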